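/- Throughout, $\mathbb N=\{0,1,2,\dots\}$, $v[i]$ is the $i$-th component of $v\in\mathbb N^n$, and $\mathbb N^n$ is ordered componentwise. **Arf semigroups.** A good semigroup is a submonoid $S$ of $\mathbb N^n$ such that (i) $\min(a,b)\in S$ for all $a,b\in S$ (componentwise minimum); (ii) if $a,b\in S$ and $a[i]=b[i]$, there is $c\in S$ with $c[i]>a[i]$, with $c[j]\ge\min(a[j],b[j])$ for all $j\ne i$, and with $c[j]=\min(a[j],b[j])$ whenever $a[j]\neq b[j]$; (iii) $\delta+\mathbb N^n\subseteq S$ for some $\delta\in S$. It is local if the zero vector is its only element with a zero component, and Arf if for every $\alpha\in S$ the set $\{\beta-\alpha:\beta\in S,\ \beta\ge\alpha\}$ is closed under addition. For $G\subseteq\mathbb N^n$, $\mathrm{Arf}(G)$ denotes the minimum, with respect to inclusion, of the set of local Arf semigroups of $\mathbb N^n$ containing $G$, if this minimum exists; "$\mathrm{Arf}(G)=S$" means that it exists and equals $S$. **Multiplicity sequences.** A multiplicity sequence is a sequence $(m_j)_{j\ge1}$ of positive integers, equal to $1$ from some index on, such that for each $j\ge1$ there is a (necessarily unique) $s_j\ge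 j+1$ with $m_j=\sum_{k=j+1}^{s_j}m_k$. Let $E$ be an ordered collection of $n$ multiplicity sequences $(m_{i,j})_{j\ge 1}$, $i=1,\dots,n$, with the corresponding integers $s_{i,j}$. For $i<j$ put $D(i,j)=\{k\ge1:s_{i,k}\ne s_{j,k}\}$ and $k_E(i,j)=\min\{\min(s_{i,k},s_{j,k}):k\in D(i,j)\}$, with $k_E(i,j)=+\infty$ if $D(i,j)=\emptyset$. Let $r(m_{i,j})$ be the number of $q$ with $1\le q<j\le s_{i,q}$, that is, the number of the sums $m_{i,q}=\sum_{k=q+1}^{s_{i,q}}m_{i,k}$ in which $m_{i,j}$ is a summand, and let $\mathrm{PChar}_E(i)=\{j\ge1:r(m_{i,j})<r(m_{i,j+1})\}$. For $j_1,\dots,j_n\in\mathbb N$ let $$V_E(j_1,\dots,j_n)=\Big[\sum_{k=1}^{j_1}m_{1,k},\dots,\sum_{k=1}^{j_n}m_{n,k}\Big].$$ **Multiplicity trees.** A multiplicity tree with branches $E$ is a rooted tree $T$ with $n$ infinite branches whose nodes are vectors of $\mathbb N^n$; write $\mathbf n_i^j$ for the node of the $i$-th branch on level $j\ge1$, so that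 $\mathbf n_i^1$ is the root for every $i$. It is required that: there is $L$ such that $\mathbf n_i^j$ is the $i$-th unit vector for all $i$ and all $j\ge L$; $\mathbf n_i^j[h]=0$ if and only if $\mathbf n_i^j$ is not in the $h$-th branch; each $\mathbf n_i^j$ is the sum of the nodes other than $\mathbf n_i^j$ of some finite subtree of $T$ rooted in $\mathbf n_i^j$; and $\mathbf n_i^j[i]=m_{i,j}$ for all $i$ and all $j\geq 1$. The set of these trees is denoted by $\tau(E)$. For $T\in\tau(E)$ let $S(T)$ consist of the zero vector and of all sums $\sum_{\mathbf n\in T'}\mathbf n$, where $T'$ ranges over the finite subtrees of $T$ containing the root, and let $\sigma(E)=\{S(T):T\in\tau(E)\}$. For $q<r$ let $p_{q,r}$ be the highest level on which the $q$-th and the $r$-th branches of $T$ are glued, that is, have the same node. **Theorem.** Let $E$ be a collection of $n$ multiplicity sequences, let $T\in\tau(E)$, so that $S(T)\in\sigma(E)$, and let $(p_{q,r})_{q<r}$ be the gluing matrix of $T$. Let $P=\{(q,r):q<r,\ p_{q,r}=k_E(q,r)\}$. Let $G(T)=\{\mathrm{Gen}(1),\dots,\mathrm{Gen}(t)\}\subseteq\mathbb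 N^n$ be a finite set. Then $\mathrm{Arf}(G(T))=S(T)$ if and only if there are integers $j_{p,i}\ge0$ ($1\le p\le t$, $1\le i\le n$) such that the following four conditions hold, where for $q<r$ $$\mathrm{MIN}_{G(T)}(q,r)=\min\Big(k_E(q,r),\ \min\{\min(j_{p,q},j_{p,r}):1\le p\le t,\ j_{p,q}\ne j_{p,r}\}\Big),$$ which is well defined if and only if $j_{p,q}\neq j_{p,r}$ for some $p$: - $\mathrm{Gen}(p)=V_E(j_{p,1},\dots,j_{p,n})$ for all $p=1,\dots,t$; - $\mathrm{PChar}_E(i)\subseteq\{j_{1,i},\dots,j_{t,i}\}$ for all $i=1,\dots,n$; - for each $(q,r)\in P$, either $j_{p,q}=j_{p,r}$ for all $p=1,\dots,t$, or $\mathrm{MIN}_{G(T)}(q,r)$ is well defined and equals $k_E(q,r)$; - for each $(q,r)\notin P$ with $q<r$, $\mathrm{MIN}_{G(T)}(q,r)$ is well defined and equals $p_{q,r}$. -/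

import Mathlib

/-! ### Arf semigroups of `ℕⁿ` -/

/-- A good semigroup of `ℕⁿ`. -/
structure IsGoodSemigroup {n : ℕ} (S : Set (Fin n → ℕ)) : Prop where
  zero_mem : 0 ∈ S
  add_mem : ∀ a ∈ S, ∀ b ∈ S, a + b ∈ S
  min_mem : ∀ a ∈ S, ∀ b ∈ S, a ⊓ b ∈ S
  exists_gt : ∀ a ∈ S, ∀ b ∈ S, ∀ i, a i = b i →
    ∃ c ∈ S, a i < c i ∧ ∀ j, j ≠ i →
      min (a j) (b j) ≤ c j ∧ (a j ≠ b j → c j = min (a j) (b j))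
  exists_conductor : ∃ δ ∈ S, ∀ x : Fin n → ℕ, δ + x ∈ S

/-- `S(α) - α = {β - α : β ∈ S, β ≥ α}`, written as the set of all `x` with `α + x ∈ S`. -/
def shiftedSet {n : ℕ} (S : Set (Fin n → ℕ)) (α : Fin n → ℕ) : Set (Fin n → ℕ) :=
  {x | α + x ∈ S}

/-- A local Arf semigroup of `ℕⁿ`: a good semigroup in which only the zero vector has a zero
component, and such that `S(α) - α` is a semigroup for every `α ∈ S`. -/
structure IsLocalArfSemigroup {n : ℕ} (S : Set (Fin n → ℕ)) : Prop where
  good : IsGoodSemigroup S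
  isLocal : ∀ a ∈ S, ∀ i, a i = 0 → a = 0
  arf : ∀ α ∈ S, ∀ x ∈ shiftedSet S α, ∀ y ∈ shiftedSet S α, x + y ∈ shiftedSet S α

/-- `Arf(G)` is well defined and equal to `S`: among the local Arf semigroups of `ℕⁿ` that
contain `G` there is a minimum with respect to inclusion, and it is `S`. -/
def ArfClosureEq {n : ℕ} (G S : Set (Fin n → ℕ)) : Prop :=
  IsLeast {S' : Set (Fin n → ℕ) | IsLocalArfSemigroup S' ∧ G ⊆ S'} S

/-! ### Multiplicity sequences -/

/-- A multiplicity sequence `m 1, m 2, …` of an Arf numerical semigroup. Terms are indexed from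
`1`; the value `m 0` is never used. -/
structure MultSeq where
  m : ℕ → ℕ
  pos : ∀ j, 1 ≤ j → 1 ≤ m j
  eventually_one : ∃ L, ∀ j, L ≤ j → m j = 1
  exists_sum : ∀ j, 1 ≤ j → ∃ s, j + 1 ≤ s ∧ m j = ∑ k ∈ Finset.Icc (j + 1) s, m k

namespace MultSeq

/-- For `j ≥ 1`, the (unique) index `s_j ≥ j + 1` with `m_j = m_{j+1} + ⋯ + m_{s_j}`. -/
noncomputable def s (M : MultSeq) (j : ℕ) : ℕ :=
  sInf {s | j + 1 ≤ s ∧ M.m j = ∑ k ∈ Finset.Icc (j + 1) s, M.m k}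

theorem s_spec (M : MultSeq) {j : ℕ} (hj : 1 ≤ j) :
    j + 1 ≤ M.s j ∧ M.m j = ∑ k ∈ Finset.Icc (j + 1) (M.s j), M.m k :=
  Nat.sInf_mem (s := {s | j + 1 ≤ s ∧ M.m j = ∑ k ∈ Finset.Icc (j + 1) s, M.m k})
    (M.exists_sum j hj)

/-- The restriction number `r(m_j)`: the number of the sums `m_q = m_{q+1} + ⋯ + m_{s_q}`,
`q ≥ 1`, in which `m_j` appears as a summand. -/
noncomputable def r (M : MultSeq) (j : ℕ) : ℕ :=
  Set.ncard {q | 1 ≤ q ∧ q + 1 ≤ j ∧ j ≤ M.s q}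

/-- The positions of the characters of a multiplicity sequence. -/
def PChar (M : MultSeq) : Set ℕ :=
  {j | 1 ≤ j ∧ M.r j < M.r (j + 1)}

end MultSeq

/-- `D(i,j)`, for a collection `E` of `n` multiplicity sequences. -/
def discrepancies {n : ℕ} (E : Fin n → MultSeq) (i j : Fin n) : Set ℕ :=
  {k | 1 ≤ k ∧ (E i).s k ≠ (E j).s k}

/-- `k_E(i,j) = min {min (s_{i,k}, s_{j,k}) : k ∈ D(i,j)}`, which is `+∞` if `D(i,j) = ∅`. -/
noncomputable def kE {n : ℕ} (E : Fin n → MultSeq) (i j : Fin n) : ℕ∞ :=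
  ⨅ k ∈ discrepancies E i j, ((min ((E i).s k) ((E j).s k) : ℕ) : ℕ∞)

/-- The vector of partial sums `V_E(j_1, …, j_n)`. -/
def vecE {n : ℕ} (E : Fin n → MultSeq) (j : Fin n → ℕ) : Fin n → ℕ :=
  fun i => ∑ k ∈ Finset.Icc 1 (j i), (E i).m k

/-! ### Multiplicity trees -/

/-- The underlying data of a rooted tree with `n` infinite branches, whose nodes are vectors of
`ℕⁿ`: `node i j` is the node `n_i^j` of the `i`-th branch on level `j`. Levels are indexed from
`1`; the values `node i 0` are never used. The branches `i` and `h` are glued at level `j` when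
`node i j = node h j`, and so a node of the tree is identified with the pair of its level and
its vector. -/
structure BranchTree (n : ℕ) where
  node : Fin n → ℕ → Fin n → ℕ
  /-- All branches are glued at level one. -/
  root : ∀ i h, node i 1 = node h 1
  /-- A node has only one parent. -/
  parent : ∀ i h j, 1 ≤ j → node i (j + 1) = node h (j + 1) → node i j = node h j

namespace BranchTree

variable {n : ℕ}

/-- `T'` is (the set of nodes, each with its level, of) a finite subtree of `T` that is rooted in
the node `n_i^j`. -/
structure IsSubtreeAt (T : BranchTree n) (i : Fin n) (j : ℕ)
    (T' : Finset (ℕ × (Fin n → ℕ))) : Prop where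
  root_mem : (j, T.node i j) ∈ T'
  /-- every element of `T'` is a node of `T` that is `n_i^j` or a descendant of it -/
  descendant : ∀ x ∈ T', ∃ h k, j ≤ k ∧ T.node h j = T.node i j ∧ x = (k, T.node h k)
  /-- `T'` contains the parent of each of its nodes other than the root -/
  parent_mem : ∀ h k, j ≤ k → (k + 1, T.node h (k + 1)) ∈ T' → (k, T.node h k) ∈ T'

/-- The multiplicity trees of local Arf semigroups of `ℕⁿ`. -/
structure IsMultiplicityTree (T : BranchTree n) : Prop where
  eventually_single : ∃ L, ∀ j, L ≤ j → ∀ i, T.node i j = Pi.single i 1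
  /-- `n_i^j[h] = 0` if and only if `n_i^j` is not in the `h`-th branch -/
  eq_zero_iff : ∀ i h j, 1 ≤ j → (T.node i j h = 0 ↔ T.node i j ≠ T.node h j)
  /-- each node is the sum of the other nodes of a finite subtree rooted in it -/
  exists_sum : ∀ i j, 1 ≤ j → ∃ T', T.IsSubtreeAt i j T' ∧
    T.node i j = ∑ x ∈ T'.erase (j, T.node i j), x.2

/-- `S(T)`: the zero vector and the sums of the nodes of the finite subtrees of `T` that are
rooted in the root of `T`. -/
def semigroup (T : BranchTree n) : Set (Fin n → ℕ) :=
  {0} ∪ {v | ∃ i T', T.IsSubtreeAt i 1 T' ∧ v = ∑ x ∈ T', x.2}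

/-- The upper triangular matrix `M(T)_E`: for `i < j` its entry `p_{i,j}` is the highest level
at which the `i`-th and the `j`-th branches are glued. -/
noncomputable def gluingMatrix (T : BranchTree n) : Matrix (Fin n) (Fin n) ℕ :=
  fun i j => if i < j then sSup {l | 1 ≤ l ∧ T.node i l = T.node j l} else 0

/-- The supremum in the definition of the gluing matrix is a maximum. -/
theorem IsMultiplicityTree.gluingMatrix_isGreatest {T : BranchTree n} (hT : T.IsMultiplicityTree)
    {i j : Fin n} (hij : i < j) :
    IsGreatest {l | 1 ≤ l ∧ T.node i l = T.node j l} (T.gluingMatrix i j) := by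
  have hne : {l | 1 ≤ l ∧ T.node i l = T.node j l}.Nonempty := ⟨1, le_rfl, T.root i j⟩
  have hb : BddAbove {l | 1 ≤ l ∧ T.node i l = T.node j l} := by
    obtain ⟨L, hL⟩ := hT.eventually_single
    refine ⟨L, fun l hl => ?_⟩
    by_contra hlt
    have h := hl.2
    rw [hL l (by omega), hL l (by omega)] at h
    have h2 := congrFun h i
    simp [hij.ne] at h2
  unfold gluingMatrix
  rw [if_pos hij]
  exact ⟨Nat.sSup_mem hne hb, fun l hl => le_csSup hb hl⟩

end BranchTree

/-- `τ(E)`: the multiplicity trees whose branches are the sequences in `E`. The set `σ(E)` is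
`{S(T) : T ∈ τ(E)}`. -/
def treesOf {n : ℕ} (E : Fin n → MultSeq) : Set (BranchTree n) :=
  {T | T.IsMultiplicityTree ∧ ∀ i j, 1 ≤ j → T.node i j i = (E i).m j}

/-! ### The integers `MIN` -/

/-- `MIN_G(q,r)` is well defined for the vectors `V_E(j p 1, …, j p n)`, `p = 1, …, t`. -/
def MinDefined {n t : ℕ} (j : Fin t → Fin n → ℕ) (q r : Fin n) : Prop :=
  ∃ p, j p q ≠ j p r

/-- The value of `MIN_G(q,r)`, meaningful under `MinDefined j q r`. -/
noncomputable def minG {n t : ℕ} (E : Fin n → MultSeq) (j : Fin t → Fin n → ℕ) (q r : Fin n) :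
    ℕ∞ :=
  min (kE E q r) (⨅ p ∈ {p | j p q ≠ j p r}, ((min (j p q) (j p r) : ℕ) : ℕ∞))

/-! A tree matters only through its gluing: the elements of `T.semigroup` are the vectors V_E(j) for
which j is constant along branches glued above the level that j reaches
(`BranchTree.semigroup_eq_indexSemigroup`). The same recipe yields a local Arf semigroup for every
gluing relation that stays below min(s_{i,k}, s_{h,k}) at each discrepancy, even after characters
are deleted from the allowed indices (`IsGluing.isLocalArfSemigroup`). Indeed V b + V c - V a is
some V d, where d, outside trivial cases, is one of the s_k (`MultSeq.exists_carry`). Such a d is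
not a character, and the identity uses only sums ending by d, so it transfers to all branches glued
beyond d.

Necessity comes from competitors. If a character is no index of a generator, delete it; if p_{q,r} <
k_E(q,r) and no generator separates q and r at p_{q,r}, glue them one level further. Either way a
local Arf semigroup contains the generators but not S(T).

For sufficiency, take any local Arf semigroup containing the generators and build by induction on
the level elements that equal V(l) on one gluing class and are arbitrarily large elsewhere
(`HasPeaks.succ`). The next index is a character, supplied by a generator, or some s_k, reached as 2
V(k) - V(k-1). Branches that part are separated by a generator or by a discrepancy, and the Arf
property amplifies the gap. Infima of these elements fill S(T)
(`indexSemigroup_subset_of_hasPeaks`). -/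

/-! ### Arithmetic of a single multiplicity sequence -/

namespace MultSeq

/-- The partial sums of a multiplicity sequence, that is, the elements of its Arf semigroup. -/
def V (M : MultSeq) (j : ℕ) : ℕ := ∑ k ∈ Finset.Icc 1 j, M.m k

@[simp] theorem V_zero (M : MultSeq) : M.V 0 = 0 := by simp [V]

theorem V_succ (M : MultSeq) (j : ℕ) : M.V (j + 1) = M.V j + M.m (j + 1) := by
  rw [V, Finset.sum_Icc_succ_top (by omega), V]

theorem V_strictMono (M : MultSeq) : StrictMono M.V :=
  strictMono_nat_of_lt_succ fun j => by
    have := M.pos (j + 1) (by omega)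
    rw [V_succ]; omega

theorem V_add_sum (M : MultSeq) {a c : ℕ} (h : a ≤ c) :
    M.V a + ∑ k ∈ Finset.Icc (a + 1) c, M.m k = M.V c := by
  induction c, h using Nat.le_induction with
  | base => simp
  | succ c hc ih => rw [Finset.sum_Icc_succ_top (by omega), ← add_assoc, ih, V_succ]

theorem lt_s (M : MultSeq) {k : ℕ} (hk : 1 ≤ k) : k < M.s k := (M.s_spec hk).1

theorem V_add_m (M : MultSeq) {k : ℕ} (hk : 1 ≤ k) : M.V k + M.m k = M.V (M.s k) := by
  have h := M.s_spec hk
  rw [h.2, M.V_add_sum (by omega)]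

theorem eq_s_of_V (M : MultSeq) {k d : ℕ} (hk : 1 ≤ k) (h : M.V k + M.m k = M.V d) :
    d = M.s k :=
  M.V_strictMono.injective (by rw [← h, M.V_add_m hk])

theorem V_two_mul (M : MultSeq) {a : ℕ} :
    M.V (a + 1) + M.V (a + 1) = M.V (M.s (a + 1)) + M.V a := by
  have h1 := M.V_add_m (k := a + 1) (by omega)
  have h2 := M.V_succ a
  omega

theorem m_lt_of_lt_s (M : MultSeq) {q k : ℕ} (hq : 1 ≤ q) (hs : M.s q ≠ q + 1) (h1 : q < k)
    (h2 : k ≤ M.s q) : M.m k < M.m q := by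
  have h := M.s_spec hq
  have hk : k ∈ Finset.Icc (q + 1) (M.s q) := Finset.mem_Icc.2 ⟨h1, h2⟩
  obtain ⟨k', hk', hne⟩ : ∃ k' ∈ Finset.Icc (q + 1) (M.s q), k' ≠ k := by
    by_cases hkq : k = q + 1
    · exact ⟨q + 2, Finset.mem_Icc.2 ⟨by omega, by omega⟩, by omega⟩
    · exact ⟨q + 1, Finset.mem_Icc.2 ⟨by omega, by omega⟩, by omega⟩
  rw [h.2]
  refine Finset.single_lt_sum hne hk hk' (M.pos k' ?_) fun _ _ _ => Nat.zero_le _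
  have := (Finset.mem_Icc.1 hk').1
  omega

theorem V_add_of_le (M : MultSeq) {L : ℕ} (hL : ∀ j, L ≤ j → M.m j = 1) (x : ℕ) :
    M.V (L + x) = M.V L + x := by
  induction x with
  | zero => rfl
  | succ x ih => rw [← add_assoc, V_succ, ih, hL _ (by omega), add_assoc]

/-- The sums containing m_{j+1} are that of m_j itself and those containing m_j that do not stop
there. So r increases exactly when no sum stops at j. -/
theorem mem_PChar_iff (M : MultSeq) {j : ℕ} :
    j ∈ M.PChar ↔ 1 ≤ j ∧ ∀ k, 1 ≤ k → M.s k ≠ j := by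
  refine and_congr_right fun hj => ?_
  set A := {q | 1 ≤ q ∧ q + 1 ≤ j ∧ j ≤ M.s q} with hA
  set B := {q | 1 ≤ q ∧ q + 1 ≤ j ∧ j + 1 ≤ M.s q} with hB
  have hAfin : A.Finite := (Set.finite_lt_nat j).subset fun q hq => hq.2.1
  have hBA : B ⊆ A := fun q hq => ⟨hq.1, hq.2.1, by have := hq.2.2; omega⟩
  have hr : M.r (j + 1) = B.ncard + 1 := by
    rw [← Set.ncard_insert_of_notMem (a := j) (s := B) (fun h => by have := h.2.1; omega)
      (hAfin.subset hBA)]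
    refine congrArg Set.ncard (Set.ext fun q => ?_)
    have := M.lt_s hj
    simp only [hB, Set.mem_ofPred_eq, Set.mem_insert_iff]
    constructor
    · rintro ⟨h1, h2, h3⟩
      by_cases hqj : q = j
      · exact Or.inl hqj
      · exact Or.inr ⟨h1, by omega, h3⟩
    · rintro (rfl | ⟨h1, h2, h3⟩)
      · exact ⟨hj, le_rfl, this⟩
      · exact ⟨h1, by omega, h3⟩
  have hr' : M.r j = A.ncard := rfl
  rw [hr, hr', Nat.lt_succ_iff]
  constructor
  · intro hle k hk hkj
    have hEq := Set.eq_of_subset_of_ncard_le hBA hle hAfin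
    have hkA : k ∈ A := ⟨hk, by have := M.lt_s hk; omega, hkj.ge⟩
    rw [← hEq] at hkA
    have := hkA.2.2
    omega
  · intro h
    refine Set.ncard_le_ncard (fun q hq => ⟨hq.1, hq.2.1, ?_⟩) (hAfin.subset hBA)
    have := h q hq.1
    have := hq.2.2
    omega

/-- The equality `V b + V c = V d + V a` holds by virtue of the relations
`m_k = m_{k+1} + ⋯ + m_{s_k}` with `s_k ≤ d` alone, and `d` is one of the numbers `s_k`. -/
def Carry (M : MultSeq) (a b c d : ℕ) : Prop :=
  (∃ k, 1 ≤ k ∧ M.s k = d) ∧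
    ∀ M' : MultSeq, (∀ k, 1 ≤ k → M.s k ≤ d → M'.s k = M.s k) → M'.V b + M'.V c = M'.V d + M'.V a

/-- V c - V a is added to V b one multiplicity at a time. Each addition raises the index by at least
one, whence the bound on d. -/
theorem exists_carry_of_forall_succ (M : MultSeq) {a b c : ℕ} (hab : a < b) (hac : a < c)
    (H : ∀ k, a ≤ k → k < c → ∀ b, k < b → ∃ d, b < d ∧ M.Carry k b (k + 1) d) :
    ∃ d, b + c ≤ d + a ∧ M.Carry a b c d := by
  induction c, (show a + 1 ≤ c from hac) using Nat.le_induction with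
  | base =>
    obtain ⟨d, h1, h2⟩ := H a le_rfl (by omega) b hab
    exact ⟨d, by omega, h2⟩
  | succ c hc ih =>
    obtain ⟨d, h1, h2⟩ := ih (by omega) fun k hk hk' => H k hk (by omega)
    obtain ⟨d', h3, h4⟩ := H c (by omega) (by omega) d (by omega)
    refine ⟨d', by omega, h4.1, fun M' hM' => ?_⟩
    have e1 := h2.2 M' fun k hk hkd => hM' k hk (by omega)
    have e2 := h4.2 M' hM'
    omega

/-- To add m_{a+1} to V b, replace it by the terms of its sum. If there are several, each is smaller
and the induction on the multiplicity applies to them in turn; a single term has the same size but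
starts closer to b. The recursion ends at b = a + 1, where V b + m_b = V(s_b). -/
theorem exists_carry_succ (M : MultSeq) {a b : ℕ} (hab : a < b) :
    ∃ d, b < d ∧ M.Carry a b (a + 1) d := by
  induction hw : M.m (a + 1) using Nat.strong_induction_on generalizing a b with
  | _ w ih =>
  induction hg : b - a generalizing a with
  | zero => omega
  | succ g ihg =>
  have hs := M.lt_s (k := a + 1) (by omega)
  by_cases hb : b = a + 1
  · subst hb
    refine ⟨M.s (a + 1), hs, ⟨a + 1, by omega, rfl⟩, fun M' hM' => ?_⟩
    rw [← hM' (a + 1) (by omega) le_rfl, M'.V_two_mul]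
  by_cases hs' : M.s (a + 1) = a + 1 + 1
  · have hm : M.m (a + 1 + 1) = w := by
      have h := M.V_add_m (k := a + 1) (by omega)
      rw [hs', V_succ _ (a + 1)] at h
      omega
    obtain ⟨d, hd, hk, hc⟩ := ihg (by omega) hm (by omega)
    refine ⟨d, hd, hk, fun M' hM' => ?_⟩
    have e1 := hc M' hM'
    have e2 := M'.V_two_mul (a := a)
    rw [hM' (a + 1) (by omega) (by omega), hs'] at e2
    omega
  · obtain ⟨d, hd, hk, hc⟩ := M.exists_carry_of_forall_succ (a := a + 1) (b := b)
      (c := M.s (a + 1)) (by omega) (by omega) fun k hk hk' b' hb' =>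
        ih _ (hw ▸ M.m_lt_of_lt_s (by omega) hs' (by omega) (by omega)) hb' rfl
    refine ⟨d, by omega, hk, fun M' hM' => ?_⟩
    have e1 := hc M' hM'
    have e2 := M'.V_two_mul (a := a)
    rw [hM' (a + 1) (by omega) (by omega)] at e2
    omega

theorem exists_carry (M : MultSeq) {a b c : ℕ} (hab : a < b) (hac : a < c) :
    ∃ d, b + c ≤ d + a ∧ M.Carry a b c d :=
  M.exists_carry_of_forall_succ hab hac fun _ _ _ _ h => M.exists_carry_succ h

end MultSeq

/-! ### Local Arf semigroups from gluing data -/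

/-- `j` is constant along the branches that are glued above the level that `j` reaches on them;
`R l i h` stands for the gluing of the branches `i` and `h` at level `l + 1`. -/
def Compatible {n : ℕ} (R : ℕ → Fin n → Fin n → Prop) (j : Fin n → ℕ) : Prop :=
  ∀ i h, R (j i) i h → j h = j i

/-- Gluing data that the collection `E` admits. -/
structure IsGluing {n : ℕ} (E : Fin n → MultSeq) (R : ℕ → Fin n → Fin n → Prop) : Prop where
  symm : ∀ l i h, R l i h → R l h i
  anti : ∀ l i h, R (l + 1) i h → R l i h
  root : ∀ i h, R 0 i h
  eventually_eq : ∃ B, ∀ l, B ≤ l → ∀ i h, R l i h → i = h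
  lt_s : ∀ l i h, R l i h → ∀ k, 1 ≤ k → (E i).s k ≠ (E h).s k → l < min ((E i).s k) ((E h).s k)

/-- The vectors `V_E(j)` with `j` compatible with `R` and avoiding the positions in `X`. -/
def indexSemigroup {n : ℕ} (E : Fin n → MultSeq) (R : ℕ → Fin n → Fin n → Prop)
    (X : Fin n → Set ℕ) : Set (Fin n → ℕ) :=
  {v | ∃ j, Compatible R j ∧ (∀ i, j i ∉ X i) ∧ v = vecE E j}

section

variable {n : ℕ} {E : Fin n → MultSeq} {R : ℕ → Fin n → Fin n → Prop} {X : Fin n → Set ℕ}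

theorem vecE_apply (E : Fin n → MultSeq) (j : Fin n → ℕ) (i : Fin n) :
    vecE E j i = (E i).V (j i) := rfl

theorem vecE_injective (E : Fin n → MultSeq) : Function.Injective (vecE E) := fun _ _ h =>
  funext fun i => (E i).V_strictMono.injective (congrFun h i)

theorem vecE_inf (E : Fin n → MultSeq) (a b : Fin n → ℕ) :
    vecE E a ⊓ vecE E b = vecE E (a ⊓ b) :=
  funext fun i => ((E i).V_strictMono.monotone.map_min).symm

theorem IsGluing.anti_le (hR : IsGluing E R) {l l' : ℕ} (hl : l ≤ l') {i h : Fin n}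
    (h' : R l' i h) : R l i h := by
  induction l', hl using Nat.le_induction with
  | base => exact h'
  | succ l' _ ih => exact ih (hR.anti _ _ _ h')

/-- If the minimum at i is a i, then a h = a i. A smaller b h would be carried back to i, because
gluing persists at lower levels. -/
theorem IsGluing.compatible_inf (hR : IsGluing E R) {a b : Fin n → ℕ} (ha : Compatible R a)
    (hb : Compatible R b) : Compatible R (a ⊓ b) := by
  have key : ∀ a b : Fin n → ℕ, Compatible R a → Compatible R b → ∀ i h, a i ≤ b i →
      R (a i) i h → min (a h) (b h) = a i := by
    intro a b ha hb i h hle hr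
    have h1 := ha i h hr
    rw [h1, min_eq_left]
    by_contra hlt
    have h2 := hb h i (hR.symm _ _ _ (hR.anti_le (by omega) hr))
    omega
  intro i h hr
  simp only [Pi.inf_apply] at hr ⊢
  rcases le_total (a i) (b i) with hle | hle
  · rw [min_eq_left hle] at hr ⊢
    exact key a b ha hb i h hle hr
  · rw [min_eq_right hle] at hr ⊢
    rw [min_comm]
    exact key b a hb ha i h hle hr

/-- The indices of `V_E(b) + V_E(c) - V_E(a)`. -/
theorem MultSeq.exists_carry_index (M : MultSeq) {a b c : ℕ} (hab : a ≤ b) (hac : a ≤ c) :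
    ∃ d, b ≤ d ∧ c ≤ d ∧ (d = b ∨ d = c ∨ d ∉ M.PChar) ∧
      ∀ M' : MultSeq, (∀ k, 1 ≤ k → M.s k ≤ d → M'.s k = M.s k) →
        M'.V b + M'.V c = M'.V d + M'.V a := by
  rcases hab.eq_or_lt with rfl | hab
  · exact ⟨c, hac, le_rfl, by simp, fun M' _ => by omega⟩
  rcases hac.eq_or_lt with rfl | hac
  · exact ⟨b, le_rfl, hab.le, by simp, fun M' _ => by omega⟩
  obtain ⟨d, hd, ⟨k, hk, hkd⟩, h⟩ := M.exists_carry hab hac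
  exact ⟨d, by omega, by omega, Or.inr (Or.inr fun hP => (M.mem_PChar_iff.1 hP).2 k hk hkd), h⟩

/-- Branches glued above d i have the same s_k whenever s_k ≤ d i, so the identity defining d i on
one also holds on the other and forces equal indices. A new index is not a character, so it avoids
`X`. -/
theorem IsGluing.arf_mem (hR : IsGluing E R) (hX : ∀ i, X i ⊆ (E i).PChar) {a x y : Fin n → ℕ}
    (ha : a ∈ indexSemigroup E R X) (hx : a + x ∈ indexSemigroup E R X)
    (hy : a + y ∈ indexSemigroup E R X) : a + (x + y) ∈ indexSemigroup E R X := by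
  obtain ⟨a, ha, -, rfl⟩ := ha
  obtain ⟨b, hb, hbX, hx⟩ := hx
  obtain ⟨c, hc, hcX, hy⟩ := hy
  have hab : ∀ i, a i ≤ b i := fun i => (E i).V_strictMono.le_iff_le.1 <| by
    have := congrFun hx i
    simp only [Pi.add_apply, vecE_apply] at this
    omega
  have hac : ∀ i, a i ≤ c i := fun i => (E i).V_strictMono.le_iff_le.1 <| by
    have := congrFun hy i
    simp only [Pi.add_apply, vecE_apply] at this
    omega
  choose d hbd hcd hdX hd using fun i => (E i).exists_carry_index (hab i) (hac i)
  refine ⟨d, fun i h hr => ?_, fun i hi => ?_, funext fun i => ?_⟩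
  · have e := hd i (E h) fun k hk hkd => by
      by_contra hne
      have := hR.lt_s _ _ _ hr k hk (Ne.symm hne)
      omega
    have e' := hd h (E h) fun _ _ _ => rfl
    have e1 := ha i h (hR.anti_le (by have := hab i; have := hbd i; omega) hr)
    have e2 := hb i h (hR.anti_le (hbd i) hr)
    have e3 := hc i h (hR.anti_le (hcd i) hr)
    rw [e1, e2, e3] at e'
    exact (E h).V_strictMono.injective (by omega)
  · rcases hdX i with h | h | h
    · exact hbX i (h ▸ hi)
    · exact hcX i (h ▸ hi)
    · exact h (hX i hi)
  · have e := hd i (E i) fun _ _ _ => rfl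
    have e1 := congrFun hx i
    have e2 := congrFun hy i
    simp only [Pi.add_apply, vecE_apply] at e1 e2 ⊢
    omega

theorem IsGluing.exists_gt (hR : IsGluing E R) {B : ℕ}
    (hB : ∀ l, B ≤ l → ∀ i h, R l i h → i = h) (hBX : ∀ l, B ≤ l → ∀ i, l ∉ X i)
    {a b : Fin n → ℕ} (ha : Compatible R a) (hb : Compatible R b) (haX : ∀ i, a i ∉ X i)
    (hbX : ∀ i, b i ∉ X i) {i : Fin n} (hi : a i = b i) :
    ∃ c, Compatible R c ∧ (∀ i, c i ∉ X i) ∧ a i < c i ∧ ∀ j, j ≠ i →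
      min (a j) (b j) ≤ c j ∧ (a j ≠ b j → c j = min (a j) (b j)) := by
  classical
  set l := a i with hl
  -- `R l` need not be transitive (`GluedFurther` may fail to be), so chains of glued branches are
  -- raised together.
  let I : Fin n → Prop := Relation.ReflTransGen (R l) i
  have hI : ∀ h, I h → a h = l ∧ b h = l := by
    intro h hh
    induction hh with
    | refl => exact ⟨rfl, hi.symm⟩
    | tail _ hr ih => exact ⟨ih.1 ▸ ha _ _ (ih.1.symm ▸ hr), (hb _ _ (ih.2.symm ▸ hr)).trans ih.2⟩
  have hmin := hR.compatible_inf ha hb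
  -- From `B` on, distinct branches are not glued and no index is excluded, so the raised value is
  -- harmless.
  refine ⟨fun h => if I h then l + 1 + B else (a ⊓ b) h, fun u v huv => ?_, fun h => ?_, ?_,
    fun h _ => ?_⟩
  · by_cases hu : I u
    · simp only [if_pos hu] at huv
      rw [hB _ (by omega) _ _ huv]
    · simp only [if_neg hu] at huv ⊢
      have e := hmin u v huv
      rw [if_neg, e]
      intro hv
      obtain ⟨e1, e2⟩ := hI v hv
      have e3 : (a ⊓ b) v = l := by simp [e1, e2]
      rw [← e, e3] at huv
      exact hu (hv.tail (hR.symm _ _ _ huv))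
  · dsimp only
    split_ifs
    · exact hBX _ (by omega) h
    · rcases min_choice (a h) (b h) with e | e
      · simpa [e] using haX h
      · simpa [e] using hbX h
  · have : I i := .refl
    simp only [if_pos this]
    omega
  · dsimp only
    split_ifs with hh
    · obtain ⟨e1, e2⟩ := hI h hh
      exact ⟨by omega, fun hne => absurd (e1.trans e2.symm) hne⟩
    · exact ⟨le_rfl, fun _ => rfl⟩

theorem IsGluing.isLocalArfSemigroup (hR : IsGluing E R) (hX : ∀ i, X i ⊆ (E i).PChar)
    (hXb : ∃ B, ∀ l, B ≤ l → ∀ i, l ∉ X i) : IsLocalArfSemigroup (indexSemigroup E R X) := by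
  obtain ⟨B₁, hB₁⟩ := hR.eventually_eq
  obtain ⟨B₂, hB₂⟩ := hXb
  have hzero : (0 : Fin n → ℕ) ∈ indexSemigroup E R X :=
    ⟨0, fun _ _ _ => rfl, fun i hi => absurd (hX i hi).1 (by simp),
      funext fun i => by simp [vecE_apply]⟩
  refine ⟨⟨hzero, fun a ha b hb => ?_, ?_, ?_, ?_⟩, ?_, fun a ha x hx y hy =>
    hR.arf_mem hX ha hx hy⟩
  -- Closure under addition is the Arf property at zero.
  · have h := hR.arf_mem hX hzero (x := a) (y := b) (by rwa [zero_add]) (by rwa [zero_add])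
    rwa [zero_add] at h
  · rintro _ ⟨a, ha, haX, rfl⟩ _ ⟨b, hb, hbX, rfl⟩
    refine ⟨a ⊓ b, hR.compatible_inf ha hb, fun i => ?_, vecE_inf E a b⟩
    rcases min_choice (a i) (b i) with e | e
    · simpa [e] using haX i
    · simpa [e] using hbX i
  · rintro _ ⟨a, ha, haX, rfl⟩ _ ⟨b, hb, hbX, rfl⟩ i hi
    obtain ⟨c, hc, hcX, hac, h⟩ := hR.exists_gt (B := max B₁ B₂)
      (fun l hl => hB₁ l (by omega)) (fun l hl => hB₂ l (by omega)) ha hb haX hbX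
      ((E i).V_strictMono.injective hi)
    refine ⟨_, ⟨c, hc, hcX, rfl⟩, (E i).V_strictMono hac, fun j hj => ?_⟩
    simp only [vecE_apply, ← (E j).V_strictMono.monotone.map_min]
    exact ⟨(E j).V_strictMono.monotone (h j hj).1, fun hne =>
      congrArg _ ((h j hj).2 fun e => hne (congrArg _ e))⟩
  · choose L hL using fun i => (E i).eventually_one
    -- Past `K` all multiplicities are 1, so every integer vector above V_E(K, …, K) is a vector of
    -- partial sums.
    let K := B₁ + B₂ + ∑ i, L i
    have hLK : ∀ i, L i ≤ K := fun i =>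
      (Finset.single_le_sum (fun _ _ => Nat.zero_le _) (Finset.mem_univ i)).trans
        (Nat.le_add_left _ _)
    have hK : ∀ x : Fin n → ℕ, vecE E (fun i => K + x i) ∈ indexSemigroup E R X := fun x =>
      ⟨_, fun i h hr => by rw [hB₁ _ (by omega) i h hr], fun i => hB₂ _ (by omega) i, rfl⟩
    refine ⟨_, hK 0, fun x => ?_⟩
    convert hK x using 1
    funext i
    simp [vecE_apply, (E i).V_add_of_le fun j hj => hL i j ((hLK i).trans hj)]
  · rintro _ ⟨a, ha, -, rfl⟩ i hi
    have hai : a i = 0 := (E i).V_strictMono.injective (by simpa [vecE_apply] using hi)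
    funext h
    rw [vecE_apply, ha i h (hai ▸ hR.root i h), hai]
    simp

end

/-! ### Multiplicity trees as gluing data -/

namespace BranchTree

variable {n : ℕ} {T : BranchTree n}

/-- The branches `i` and `h` are glued at level `l + 1`. -/
def Glued (T : BranchTree n) (l : ℕ) (i h : Fin n) : Prop :=
  T.node i (l + 1) = T.node h (l + 1)

theorem node_eq_of_le (T : BranchTree n) {i h : Fin n} {k l : ℕ} (hk : 1 ≤ k) (hkl : k ≤ l)
    (h' : T.node i l = T.node h l) : T.node i k = T.node h k := by
  induction l, hkl using Nat.le_induction with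
  | base => exact h'
  | succ l hl ih => exact ih (T.parent i h l (by omega) h')

/-- On each branch through its root, a finite subtree is an initial segment. -/
theorem IsSubtreeAt.exists_height {i : Fin n} {j : ℕ} {T' : Finset (ℕ × (Fin n → ℕ))}
    (hT' : T.IsSubtreeAt i j T') {h : Fin n} (hh : T.node h j = T.node i j) :
    ∃ J, j ≤ J ∧ ∀ k, j ≤ k → ((k, T.node h k) ∈ T' ↔ k ≤ J) := by
  have hmem : (j, T.node h j) ∈ T' := hh ▸ hT'.root_mem
  have hfin : {k | (k, T.node h k) ∈ T'}.Finite :=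
    Set.Finite.of_injOn (f := fun k => (k, T.node h k)) (t := T') (fun _ hk => hk)
      (fun _ _ _ _ e => (Prod.mk.inj e).1) T'.finite_toSet
  refine ⟨sSup {k | (k, T.node h k) ∈ T'}, le_csSup hfin.bddAbove hmem, fun k hk =>
    ⟨fun hkm => le_csSup hfin.bddAbove hkm, fun hkJ => ?_⟩⟩
  have hJ : (_, T.node h _) ∈ T' := Nat.sSup_mem ⟨j, hmem⟩ hfin.bddAbove
  generalize sSup {k | (k, T.node h k) ∈ T'} = J at hkJ hJ
  induction J, hkJ using Nat.le_induction with
  | base => exact hJ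
  | succ J hkJ ih => exact ih (hT'.parent_mem h J (by omega) hJ)

theorem IsMultiplicityTree.sum_apply (hT : T.IsMultiplicityTree) {h : Fin n} {j J : ℕ}
    (hj : 1 ≤ j) {T' : Finset (ℕ × (Fin n → ℕ))}
    (hnode : ∀ x ∈ T', ∃ g k, j ≤ k ∧ x = (k, T.node g k))
    (hJ : ∀ k, j ≤ k → ((k, T.node h k) ∈ T' ↔ k ≤ J)) :
    (∑ x ∈ T', x.2) h = ∑ k ∈ Finset.Icc j J, T.node h k h := by
  classical
  rw [Finset.sum_apply]
  have hinj : Function.Injective fun k => (k, T.node h k) := fun _ _ e => (Prod.mk.inj e).1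
  have e : ∑ k ∈ Finset.Icc j J, T.node h k h =
      ∑ x ∈ (Finset.Icc j J).map ⟨_, hinj⟩, x.2 h := by
    rw [Finset.sum_map]
    rfl
  rw [e]
  refine (Finset.sum_subset (fun x hx => ?_) fun x hx hx' => ?_).symm
  · obtain ⟨k, hk, rfl⟩ := Finset.mem_map.1 hx
    exact (hJ k (Finset.mem_Icc.1 hk).1).2 (Finset.mem_Icc.1 hk).2
  · obtain ⟨g, k, hk, rfl⟩ := hnode x hx
    refine (hT.eq_zero_iff g h k (hj.trans hk)).2 fun hgh => hx' ?_
    rw [hgh] at hx ⊢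
    exact Finset.mem_map.2 ⟨k, Finset.mem_Icc.2 ⟨hk, (hJ k hk).1 hx⟩, rfl⟩

/-- Inside the subtree whose sum is the node `n_i^k`, the branch `h` ends at level `s_{h,k}`. -/
theorem IsMultiplicityTree.mem_iff_le_s (hT : T.IsMultiplicityTree) {E : Fin n → MultSeq}
    (hE : ∀ i j, 1 ≤ j → T.node i j i = (E i).m j) {i h : Fin n} {k : ℕ} (hk : 1 ≤ k)
    (hh : T.node h k = T.node i k) {T' : Finset (ℕ × (Fin n → ℕ))} (hT' : T.IsSubtreeAt i k T')
    (hsum : T.node i k = ∑ x ∈ T'.erase (k, T.node i k), x.2) :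
    ∀ l, k ≤ l → ((l, T.node h l) ∈ T' ↔ l ≤ (E h).s k) := by
  obtain ⟨J, hJ, hmem⟩ := hT'.exists_height hh
  have h1 := hT.sum_apply hk (fun x hx => by
    obtain ⟨g, l, hl, -, rfl⟩ := hT'.descendant x hx
    exact ⟨g, l, hl, rfl⟩) hmem
  rw [← Finset.add_sum_erase _ _ hT'.root_mem, ← hsum, Pi.add_apply, ← hh,
    Finset.sum_congr rfl fun l hl => hE h l (hk.trans (Finset.mem_Icc.1 hl).1), hE h k hk] at h1
  obtain ⟨k, rfl⟩ : ∃ k', k = k' + 1 := ⟨k - 1, by omega⟩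
  have h2 := (E h).V_add_sum (a := k) (c := J) (by omega)
  have h3 : J = (E h).s (k + 1) := (E h).eq_s_of_V hk (by
    rw [← h2, ← h1, MultSeq.V_succ, add_assoc, ← hE h _ hk])
  rwa [← h3]

/-- The last condition holds because the subtree summing to n_i^k leaves each branch h through that
node at level s_{h,k}. If s_{i,k} < s_{h,k}, it contains the node of h at level s_{i,k} + 1 but not
that of i, so the two nodes differ. -/
theorem isGluing_of_mem_treesOf {E : Fin n → MultSeq} (hT : T ∈ treesOf E) :
    IsGluing E T.Glued := by
  obtain ⟨hT, hE⟩ := hT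
  refine ⟨fun l i h e => e.symm, fun l i h e => T.parent i h _ (by omega) e, T.root, ?_, ?_⟩
  · obtain ⟨L, hL⟩ := hT.eventually_single
    refine ⟨L, fun l hl i h e => ?_⟩
    rw [Glued, hL _ (by omega), hL _ (by omega)] at e
    by_contra hne
    have := congrFun e i
    simp [hne] at this
  · have key : ∀ l i h, T.Glued l i h → ∀ k, 1 ≤ k → (E i).s k < (E h).s k → l < (E i).s k := by
      intro l i h e k hk hlt
      by_contra hle
      have hks := (E i).lt_s hk
      obtain ⟨T', hT', hsum⟩ := hT.exists_sum i k hk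
      have e1 := hT.mem_iff_le_s hE hk rfl hT' hsum ((E i).s k + 1) (by omega)
      have e2 := hT.mem_iff_le_s hE hk (T.node_eq_of_le hk (by omega) e).symm hT' hsum
        ((E i).s k + 1) (by omega)
      rw [T.node_eq_of_le (by omega) (by omega) e, e2] at e1
      omega
    intro l i h e k hk hne
    rcases lt_or_gt_of_ne hne with hlt | hlt
    · have := key l i h e k hk hlt
      omega
    · have := key l h i e.symm k hk hlt
      omega

/-- A finite subtree is recorded by its heights on the branches. Compatibility says that these
heights agree on shared nodes. -/
theorem semigroup_eq_indexSemigroup {E : Fin n → MultSeq} (hT : T ∈ treesOf E) :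
    T.semigroup = indexSemigroup E T.Glued fun _ => ∅ := by
  classical
  have hR := isGluing_of_mem_treesOf hT
  obtain ⟨hT, hE⟩ := hT
  have hV : ∀ h J, ∑ k ∈ Finset.Icc 1 J, T.node h k h = (E h).V J := fun h J =>
    Finset.sum_congr rfl fun k hk => hE h k (Finset.mem_Icc.1 hk).1
  ext v
  constructor
  · rintro (rfl | ⟨i, T', hT', rfl⟩)
    · exact ⟨0, fun _ _ _ => rfl, by simp, funext fun i => by simp [vecE_apply]⟩
    choose j hj1 hj using fun h => hT'.exists_height (T.root h i)
    refine ⟨j, fun i h e => ?_, by simp, funext fun h => ?_⟩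
    · have h1 := hj i (j i + 1) (by omega)
      have h2 := hj i (j i) (hj1 i)
      rw [show T.node i (j i + 1) = T.node h (j i + 1) from e, hj h _ (by omega)] at h1
      rw [T.node_eq_of_le (hj1 i) (by omega) e, hj h _ (hj1 i)] at h2
      omega
    · rw [hT.sum_apply le_rfl (fun x hx => ?_) (hj h), hV, vecE_apply]
      obtain ⟨g, l, hl, -, rfl⟩ := hT'.descendant x hx
      exact ⟨g, l, hl, rfl⟩
  · rintro ⟨j, hj, -, rfl⟩
    by_cases h0 : ∃ i, j i = 0
    · obtain ⟨i, hi⟩ := h0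
      refine Or.inl (funext fun h => ?_)
      rw [vecE_apply, hj i h (hi ▸ T.root i h), hi]
      simp
    push Not at h0
    rcases isEmpty_or_nonempty (Fin n) with hn | ⟨⟨i⟩⟩
    · exact Or.inl (Subsingleton.elim _ _)
    let T' : Finset (ℕ × (Fin n → ℕ)) := Finset.univ.biUnion fun h =>
      (Finset.Icc 1 (j h)).image fun k => (k, T.node h k)
    have hmem : ∀ h k, 1 ≤ k → ((k, T.node h k) ∈ T' ↔ k ≤ j h) := by
      intro h k hk
      simp only [T', Finset.mem_biUnion, Finset.mem_univ, true_and, Finset.mem_image,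
        Finset.mem_Icc, Prod.mk.injEq]
      constructor
      · rintro ⟨g, k, ⟨-, hkg⟩, rfl, e⟩
        by_contra hlt
        have := hj h g (T.node_eq_of_le (by omega) (by omega) e.symm)
        omega
      · exact fun hkj => ⟨h, k, ⟨hk, hkj⟩, rfl, rfl⟩
    have hnode : ∀ x ∈ T', ∃ g k, 1 ≤ k ∧ x = (k, T.node g k) := by
      intro x hx
      simp only [T', Finset.mem_biUnion, Finset.mem_univ, true_and, Finset.mem_image,
        Finset.mem_Icc] at hx
      obtain ⟨g, k, ⟨hk, -⟩, rfl⟩ := hx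
      exact ⟨g, k, hk, rfl⟩
    refine Or.inr ⟨i, T', ⟨?_, fun x hx => ?_, fun h k hk hm => ?_⟩, funext fun h => ?_⟩
    · have := h0 i
      exact (hmem i 1 le_rfl).2 (by omega)
    · obtain ⟨g, k, hk, rfl⟩ := hnode x hx
      exact ⟨g, k, hk, T.root g i, rfl⟩
    · have := (hmem h (k + 1) (by omega)).1 hm
      exact (hmem h k hk).2 (by omega)
    · rw [hT.sum_apply le_rfl hnode (hmem h), hV, vecE_apply]

end BranchTree

/-! ### Generating elements of a local Arf semigroup level by level -/

section

variable {n : ℕ} {S : Set (Fin n → ℕ)}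

/-- Truncated subtraction turns the Arf property into closure under `x + K • (z - x)`. -/
theorem IsLocalArfSemigroup.add_nsmul_sub_mem (hS : IsLocalArfSemigroup S) {x z : Fin n → ℕ}
    (hx : x ∈ S) (hz : z ∈ S) (K : ℕ) : x + K • (z - x) ∈ S := by
  have hm := hS.good.min_mem x hx z hz
  have e : x ⊓ z + (x - z) = x := funext fun i => by
    simp only [Pi.add_apply, Pi.inf_apply, Pi.sub_apply]; omega
  have e' : x ⊓ z + (z - x) = z := funext fun i => by
    simp only [Pi.add_apply, Pi.inf_apply, Pi.sub_apply]; omega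
  -- Relative to x ⊓ z, the elements x and z become x - z and z - x, which may be added freely.
  have key : x - z + K • (z - x) ∈ shiftedSet S (x ⊓ z) := by
    induction K with
    | zero =>
      change x ⊓ z + (x - z + 0 • (z - x)) ∈ S
      rwa [zero_nsmul, add_zero, e]
    | succ K ih =>
      rw [succ_nsmul, ← add_assoc]
      refine hS.arf _ hm _ ih _ ?_
      change x ⊓ z + (z - x) ∈ S
      rwa [e']
  change x ⊓ z + (x - z + K • (z - x)) ∈ S at key
  rwa [← add_assoc, e] at key

theorem IsLocalArfSemigroup.sup_mem (hS : IsLocalArfSemigroup S) {x z : Fin n → ℕ}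
    (hx : x ∈ S) (hz : z ∈ S) : x ⊔ z ∈ S := by
  convert hS.add_nsmul_sub_mem hx hz 1 using 1
  funext i
  simp only [Pi.add_apply, Pi.sup_apply, Pi.sub_apply, one_smul]
  omega

variable {E : Fin n → MultSeq} {R : ℕ → Fin n → Fin n → Prop}

/-- On the branches that are glued with the `i`-th one at level `l + 1`, some element of `S` is the
vector of the partial sums up to the indices `f`, all larger than `l`, and the branches on which
`f` is `l + 1` form a union of gluing classes of level `l + 2`. -/
structure IsSource (S : Set (Fin n → ℕ)) (E : Fin n → MultSeq) (R : ℕ → Fin n → Fin n → Prop)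
    (l : ℕ) (i : Fin n) (f : Fin n → ℕ) : Prop where
  exists_mem : ∃ z ∈ S, ∀ g, R l i g → z g = (E g).V (f g)
  lt : ∀ g, R l i g → l < f g
  eq_of_eq : ∀ g g', R l i g → R (l + 1) g g' → f g = l + 1 → f g' = l + 1

/-- `S` has elements equal to `V_E(l, …, l)` on the branches glued with the `i`-th one at
level `l + 1`, and arbitrarily large on the other branches. -/
def HasPeaks (S : Set (Fin n → ℕ)) (E : Fin n → MultSeq) (R : ℕ → Fin n → Fin n → Prop)
    (l : ℕ) (i : Fin n) : Prop :=
  ∀ N, ∃ u ∈ S, (∀ h, R l i h → u h = (E h).V l) ∧ ∀ h, ¬ R l i h → N ≤ u h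

theorem isSource_of_compatible (hR : IsGluing E R) {f : Fin n → ℕ} (hf : Compatible R f)
    (hfS : vecE E f ∈ S) {l : ℕ} {i : Fin n} (hi : l < f i) : IsSource S E R l i f := by
  refine ⟨⟨_, hfS, fun _ _ => rfl⟩, fun g hg => ?_, fun g g' _ h e => ?_⟩
  · by_contra hle
    have := hf g i (hR.anti_le (not_lt.1 hle) (hR.symm _ _ _ hg))
    omega
  · exact (hf g g' (e.symm ▸ h)).trans e

/-- On the class, V(s_k) = 2 V(k) - V(k-1) is u + 2(v - u) for peaks u, v of levels k - 1 and k.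
Branches glued at level l + 2 cannot disagree about s_k = l + 1, by `IsGluing.lt_s`. -/
theorem isSource_s (hS : IsLocalArfSemigroup S) (hR : IsGluing E R) {l k : ℕ} {i : Fin n}
    (hk : 1 ≤ k) (hkl : k ≤ l) (hi : l < (E i).s k)
    (hP : ∀ l' ≤ l, ∀ i, HasPeaks S E R l' i) : IsSource S E R l i fun g => (E g).s k := by
  obtain ⟨k, rfl⟩ : ∃ k', k = k' + 1 := ⟨k - 1, by omega⟩
  obtain ⟨u, hu, huV, -⟩ := hP k (by omega) i 0
  obtain ⟨v, hv, hvV, -⟩ := hP (k + 1) hkl i 0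
  refine ⟨⟨_, hS.add_nsmul_sub_mem hu hv 2, fun g hg => ?_⟩, fun g hg => ?_,
    fun g g' hg hg' e => ?_⟩
  · have e1 := huV g (hR.anti_le (by omega) hg)
    have e2 := hvV g (hR.anti_le hkl hg)
    have e3 := (E g).V_two_mul (a := k)
    have e4 := (E g).V_strictMono (Nat.lt_succ_self k)
    simp only [Pi.add_apply, Pi.smul_apply, Pi.sub_apply, smul_eq_mul, e1, e2, Nat.succ_eq_add_one]
      at e4 ⊢
    omega
  · by_cases h : (E i).s (k + 1) = (E g).s (k + 1)
    · exact h ▸ hi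
    · have := hR.lt_s _ _ _ hg _ hk h
      omega
  · by_contra hne
    have := hR.lt_s _ _ _ hg' (k + 1) hk (by omega)
    omega

/-- The element equal to `V_E(l + 1, …, l + 1)` on the whole gluing class of level `l + 1`. -/
theorem exists_eq_V_succ (hS : IsLocalArfSemigroup S) (hR : IsGluing E R)
    (htrans : ∀ l i h g, R l i h → R l h g → R l i g) {l : ℕ}
    (hP : ∀ i, HasPeaks S E R l i) (hsrc : ∀ i, ∃ f, IsSource S E R l i f ∧ f i = l + 1)
    {i : Fin n} (hii : R l i i) (N : ℕ) :
    ∃ x ∈ S, (∀ h, R l i h → x h = (E h).V (l + 1)) ∧ ∀ h, ¬ R l i h → N ≤ x h := by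
  classical
  have hy : ∀ h, R l i h → ∃ y ∈ S, y h = (E h).V (l + 1) ∧
      (∀ g, R l i g → (E g).V (l + 1) ≤ y g) ∧ ∀ g, ¬ R l i g → N ≤ y g := by
    intro h hh
    -- The source attains V(l + 1) at h and is no smaller on the rest of the class; the peak lifts
    -- the other branches. The infimum over h in the class is then exact on all of it.
    obtain ⟨f, ⟨⟨z, hz, hzV⟩, hlt, -⟩, hfh⟩ := hsrc h
    obtain ⟨u, hu, huV, huN⟩ := hP i N
    have hcls : ∀ g, R l i g → R l h g := fun g hg => htrans _ _ _ _ (hR.symm _ _ _ hh) hg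
    refine ⟨z ⊔ u, hS.sup_mem hz hu, ?_, fun g hg => ?_, fun g hg => ?_⟩
    · have := (E h).V_strictMono (Nat.lt_succ_self l)
      rw [Pi.sup_apply, hzV h (hcls h hh), huV h hh, hfh, max_eq_left this.le]
    · refine le_trans ?_ (le_max_left (z g) (u g))
      rw [hzV g (hcls g hg)]
      exact (E g).V_strictMono.monotone (hlt g (hcls g hg))
    · exact (huN g hg).trans (le_max_right _ _)
  choose! y hyS hyV hyle hyN using hy
  have hne : (Finset.univ.filter (R l i)).Nonempty := ⟨i, by simpa using hii⟩
  refine ⟨(Finset.univ.filter (R l i)).inf' hne y, Finset.inf'_mem S hS.good.min_mem _ _ _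
    fun h hh => hyS h (by simpa using hh), fun h hh => ?_, fun g hg => ?_⟩
  · rw [Finset.inf'_apply]
    refine le_antisymm ?_ (Finset.le_inf' _ _ fun g hg => hyle g (by simpa using hg) h hh)
    rw [← hyV h hh]
    exact Finset.inf'_le _ (by simpa using hh)
  · rw [Finset.inf'_apply]
    exact Finset.le_inf' _ _ fun h hh => hyN h (by simpa using hh) g hg

/-- Two branches that are told apart by a source get separated. -/
theorem exists_separating (hS : IsLocalArfSemigroup S) (hR : IsGluing E R) {l : ℕ}
    {i h : Fin n} (hih : R l i h) (hih' : ¬ R (l + 1) i h) {f : Fin n → ℕ}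
    (hf : IsSource S E R l i f) (hii : R l i i) (hfne : f i ≠ f h)
    (hmin : min (f i) (f h) = l + 1) {x : Fin n → ℕ} (hx : x ∈ S)
    (hxV : ∀ g, R l i g → x g = (E g).V (l + 1)) (N : ℕ) :
    ∃ c ∈ S, (∀ g, R (l + 1) i g → c g = (E g).V (l + 1)) ∧ N ≤ c h := by
  obtain ⟨⟨z, hz, hzV⟩, hlt, heq⟩ := hf
  -- Any positive gap is enough: x + N • (c - x) widens it at h and leaves the class of i alone.
  suffices ∃ c ∈ S, (∀ g, R (l + 1) i g → c g = (E g).V (l + 1)) ∧ (E h).V (l + 1) < c h by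
    obtain ⟨c, hc, hcV, hch⟩ := this
    refine ⟨_, hS.add_nsmul_sub_mem hx hc N, fun g hg => ?_, ?_⟩
    · simp [hxV g (hR.anti _ _ _ hg), hcV g hg]
    · simp only [Pi.add_apply, Pi.smul_apply, Pi.sub_apply, smul_eq_mul, hxV h hih]
      have : N * 1 ≤ N * (c h - (E h).V (l + 1)) := Nat.mul_le_mul_left _ (by omega)
      omega
  by_cases hfi : f i = l + 1
  · refine ⟨z, hz, fun g hg => ?_, ?_⟩
    · rw [hzV g (hR.anti _ _ _ hg), heq i g hii hg hfi]
    · rw [hzV h hih]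
      exact (E h).V_strictMono (by have := hlt h hih; omega)
  -- Here z is too large at i, but x and z agree at h. The good semigroup axiom raises h, while on
  -- the class of i the minimum is the value of x.
  · have hfh : f h = l + 1 := by omega
    obtain ⟨c, hc, hch, hcg⟩ := hS.good.exists_gt x hx z hz h (by rw [hxV h hih, hzV h hih, hfh])
    refine ⟨c, hc, fun g hg => ?_, by rwa [← hxV h hih]⟩
    have hg' := hR.anti _ _ _ hg
    have hfg : f g ≠ l + 1 := fun e => hfi (heq g i hg' (hR.symm _ _ _ hg) e)
    have hlt' : (E g).V (l + 1) < (E g).V (f g) :=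
      (E g).V_strictMono (by have := hlt g hg'; omega)
    rw [(hcg g fun e => hih' (e ▸ hg)).2 (by rw [hxV g hg', hzV g hg']; exact hlt'.ne),
      hxV g hg', hzV g hg', min_eq_left hlt'.le]

/-- For each branch h to be left behind there is an element exact on the new class and large at h.
Their supremum is large at all of them simultaneously. -/
theorem HasPeaks.succ (hS : IsLocalArfSemigroup S) (hR : IsGluing E R)
    (hrefl : ∀ l i, R l i i) (htrans : ∀ l i h g, R l i h → R l h g → R l i g) {l : ℕ}
    (hP : ∀ i, HasPeaks S E R l i) (hsrc : ∀ i, ∃ f, IsSource S E R l i f ∧ f i = l + 1)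
    (hsep : ∀ i h, R l i h → ¬ R (l + 1) i h →
      ∃ f, IsSource S E R l i f ∧ f i ≠ f h ∧ min (f i) (f h) = l + 1) (i : Fin n) :
    HasPeaks S E R (l + 1) i := by
  classical
  intro N
  obtain ⟨x, hx, hxV, hxN⟩ := exists_eq_V_succ hS hR htrans hP hsrc (hrefl l i) N
  have hc : ∀ h, ∃ c ∈ S, (∀ g, R (l + 1) i g → c g = (E g).V (l + 1)) ∧
      (¬ R (l + 1) i h → N ≤ c h) := by
    intro h
    by_cases h1 : R (l + 1) i h
    · exact ⟨x, hx, fun g hg => hxV g (hR.anti _ _ _ hg), fun h' => absurd h1 h'⟩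
    by_cases h2 : R l i h
    · obtain ⟨f, hf, hfne, hmin⟩ := hsep i h h2 h1
      obtain ⟨c, hc, hcV, hcN⟩ :=
        exists_separating hS hR h2 h1 hf (hrefl l i) hfne hmin hx hxV N
      exact ⟨c, hc, hcV, fun _ => hcN⟩
    · exact ⟨x, hx, fun g hg => hxV g (hR.anti _ _ _ hg), fun _ => hxN h h2⟩
  choose c hcS hcV hcN using hc
  refine ⟨Finset.univ.sup' (Finset.univ_nonempty_iff.2 ⟨i⟩) c,
    Finset.sup'_mem S (fun a ha b hb => hS.sup_mem ha hb) _ _ _ fun h _ => hcS h,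
    fun g hg => ?_, fun g hg => ?_⟩
  · rw [Finset.sup'_apply]
    exact le_antisymm (Finset.sup'_le _ _ fun h _ => (hcV h g hg).le)
      ((hcV i g hg).ge.trans (Finset.le_sup' (fun h => c h g) (Finset.mem_univ i)))
  · rw [Finset.sup'_apply]
    exact (hcN g hg).trans (Finset.le_sup' (fun h => c h g) (Finset.mem_univ g))

theorem indexSemigroup_subset_of_hasPeaks (hS : IsLocalArfSemigroup S)
    (hrefl : ∀ l i, R l i i) (hP : ∀ l i, HasPeaks S E R l i) (X : Fin n → Set ℕ) :
    indexSemigroup E R X ⊆ S := by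
  rintro _ ⟨j, hj, -, rfl⟩
  rcases isEmpty_or_nonempty (Fin n) with hn | hn
  · rw [Subsingleton.elim (vecE E j) 0]
    exact hS.good.zero_mem
  -- The sum bounds every V_h(j h), so in the infimum a peak matters only on its own class.
  choose u huS huV huN using fun i => hP (j i) i (∑ h, (E h).V (j h))
  convert Finset.inf'_mem S hS.good.min_mem Finset.univ Finset.univ_nonempty u
    fun i _ => huS i using 1
  funext h
  rw [Finset.inf'_apply]
  refine le_antisymm (Finset.le_inf' _ _ fun i _ => ?_) ?_
  · by_cases hr : R (j i) i h
    · rw [huV i h hr, vecE_apply, hj i h hr]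
    · exact (Finset.single_le_sum (f := fun h => (E h).V (j h)) (fun _ _ => Nat.zero_le _)
        (Finset.mem_univ h)).trans (huN i h hr)
  · rw [vecE_apply, ← huV h h (hrefl _ h)]
    exact Finset.inf'_le _ (Finset.mem_univ h)

/-- A local Arf semigroup that contains vectors `V_E(j_p)` with all the characters of `E` among
their entries and with enough of them to separate the branches contains all of `S(T)`. -/
theorem indexSemigroup_subset (hS : IsLocalArfSemigroup S) (hR : IsGluing E R)
    (hrefl : ∀ l i, R l i i) (htrans : ∀ l i h g, R l i h → R l h g → R l i g) {ι : Type*}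
    {j : ι → Fin n → ℕ} (hj : ∀ p, Compatible R (j p)) (hjS : ∀ p, vecE E (j p) ∈ S)
    (hchar : ∀ i, (E i).PChar ⊆ Set.range fun p => j p i)
    (hsep : ∀ l i h, R l i h → ¬ R (l + 1) i h →
      (∃ p, j p i ≠ j p h ∧ min (j p i) (j p h) = l + 1) ∨
      ∃ k, 1 ≤ k ∧ (E i).s k ≠ (E h).s k ∧ min ((E i).s k) ((E h).s k) = l + 1)
    (X : Fin n → Set ℕ) : indexSemigroup E R X ⊆ S := by
  refine indexSemigroup_subset_of_hasPeaks hS hrefl (fun l => ?_) X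
  induction l using Nat.strong_induction_on with
  | _ l ih =>
  rcases l with _ | l
  · exact fun i N => ⟨0, hS.good.zero_mem, fun h _ => by simp, fun h hh =>
      absurd (hR.root i h) hh⟩
  have hP : ∀ l' ≤ l, ∀ i, HasPeaks S E R l' i := fun l' hl' => ih l' (by omega)
  refine HasPeaks.succ hS hR hrefl htrans (hP l le_rfl) (fun i => ?_) fun i h hr hr' => ?_
  · by_cases hc : l + 1 ∈ (E i).PChar
    · obtain ⟨p, hp⟩ := hchar i hc
      dsimp only at hp
      exact ⟨j p, isSource_of_compatible hR (hj p) (hjS p) (by omega), hp⟩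
    · rw [MultSeq.mem_PChar_iff] at hc
      push Not at hc
      obtain ⟨k, hk, hks⟩ := hc (by omega)
      have := (E i).lt_s hk
      exact ⟨_, isSource_s hS hR hk (by omega) (by omega) hP, hks⟩
  · rcases hsep l i h hr hr' with ⟨p, hne, hmin⟩ | ⟨k, hk, hne, hmin⟩
    · exact ⟨j p, isSource_of_compatible hR (hj p) (hjS p) (by omega), hne, hmin⟩
    · have hkl : k ≤ l := by
        have := (E i).lt_s hk
        have := (E h).lt_s hk
        omega
      exact ⟨_, isSource_s hS hR hk hkl (by omega) hP, hne, hmin⟩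

end

/-! ### The gluing matrix, k_E and MIN -/

theorem exists_eq_of_biInf_eq_natCast {ι : Type*} {A : Set ι} {f : ι → ℕ} {a : ℕ}
    (h : ⨅ p ∈ A, (f p : ℕ∞) = a) : ∃ p ∈ A, f p = a := by
  by_contra! hne
  have h1 : ((a + 1 : ℕ) : ℕ∞) ≤ ⨅ p ∈ A, (f p : ℕ∞) := le_iInf₂ fun p hp => by
    have h2 : (a : ℕ∞) ≤ f p := h ▸ iInf₂_le p hp
    have := hne p hp
    norm_cast at h2 ⊢
    omega
  rw [h] at h1
  norm_cast at h1
  omega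

theorem kE_le {n : ℕ} (E : Fin n → MultSeq) {q r : Fin n} {k : ℕ} (hk : 1 ≤ k)
    (h : (E q).s k ≠ (E r).s k) : kE E q r ≤ (min ((E q).s k) ((E r).s k) : ℕ) :=
  iInf₂_le (f := fun k (_ : k ∈ discrepancies E q r) =>
    ((min ((E q).s k) ((E r).s k) : ℕ) : ℕ∞)) k ⟨hk, h⟩

theorem minG_le {n t : ℕ} (E : Fin n → MultSeq) (j : Fin t → Fin n → ℕ) {q r : Fin n} {p : Fin t}
    (h : j p q ≠ j p r) : minG E j q r ≤ (min (j p q) (j p r) : ℕ) :=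
  (min_le_right _ _).trans <| iInf₂_le
    (f := fun p (_ : p ∈ {p | j p q ≠ j p r}) => ((min (j p q) (j p r) : ℕ) : ℕ∞)) p h

namespace BranchTree

variable {n : ℕ} {T : BranchTree n}

theorem IsMultiplicityTree.glued_iff (hT : T.IsMultiplicityTree) {q r : Fin n} (hqr : q < r)
    {l : ℕ} : T.Glued l q r ↔ l < T.gluingMatrix q r := by
  obtain ⟨⟨h1, h2⟩, h3⟩ := hT.gluingMatrix_isGreatest hqr
  exact ⟨fun h => h3 ⟨by omega, h⟩, fun h => T.node_eq_of_le (by omega) h h2⟩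

theorem gluingMatrix_le_kE {E : Fin n → MultSeq} (hT : T ∈ treesOf E) {q r : Fin n}
    (hqr : q < r) : (T.gluingMatrix q r : ℕ∞) ≤ kE E q r := by
  refine le_iInf₂ fun k hk => ?_
  have h1 := (hT.1.gluingMatrix_isGreatest hqr).1.1
  have := (isGluing_of_mem_treesOf hT).lt_s (T.gluingMatrix q r - 1) q r
    ((hT.1.glued_iff hqr).2 (by omega)) k hk.1 hk.2
  exact_mod_cast (show T.gluingMatrix q r ≤ _ by omega)

theorem gluingMatrix_le_of_compatible (hT : T.IsMultiplicityTree) {j : Fin n → ℕ}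
    (hj : Compatible T.Glued j) {q r : Fin n} (hqr : q < r) (hne : j q ≠ j r) :
    T.gluingMatrix q r ≤ min (j q) (j r) := by
  by_contra! hlt
  rcases le_total (j q) (j r) with hle | hle
  · rw [min_eq_left hle] at hlt
    exact hne (hj q r ((hT.glued_iff hqr).2 hlt)).symm
  · rw [min_eq_right hle] at hlt
    exact hne (hj r q (((hT.glued_iff hqr).2 hlt).symm))

/-- The gluing of `T` with the branches `q` and `r` glued one level further. -/
def GluedFurther (T : BranchTree n) (q r : Fin n) (l : ℕ) (i h : Fin n) : Prop :=
  T.Glued l i h ∨ l = T.gluingMatrix q r ∧ (i = q ∧ h = r ∨ i = r ∧ h = q)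

/-- The strict inequality is exactly the room that `IsGluing.lt_s` needs for the added pair. -/
theorem isGluing_gluedFurther {E : Fin n → MultSeq} (hT : T ∈ treesOf E) {q r : Fin n}
    (hqr : q < r) (hlt : (T.gluingMatrix q r : ℕ∞) < kE E q r) :
    IsGluing E (T.GluedFurther q r) := by
  have hR := isGluing_of_mem_treesOf hT
  refine ⟨fun l i h => Or.imp (hR.symm l i h) (by tauto), ?_, fun i h => Or.inl (hR.root i h),
    ?_, ?_⟩
  · rintro l i h (hr | ⟨hl, hi⟩)
    · exact Or.inl (hR.anti l i h hr)
    · have hg := (hT.1.glued_iff hqr (l := l)).2 (by omega)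
      rcases hi with ⟨rfl, rfl⟩ | ⟨rfl, rfl⟩
      · exact Or.inl hg
      · exact Or.inl hg.symm
  · obtain ⟨B, hB⟩ := hR.eventually_eq
    refine ⟨max B (T.gluingMatrix q r + 1), fun l hl i h hr => ?_⟩
    exact hB l (by omega) i h (hr.resolve_right fun h' => by omega)
  · have key : ∀ k, 1 ≤ k → (E q).s k ≠ (E r).s k →
        T.gluingMatrix q r < min ((E q).s k) ((E r).s k) := fun k hk hne => by
      exact_mod_cast hlt.trans_le (kE_le E hk hne)
    rintro l i h (hr | ⟨rfl, ⟨rfl, rfl⟩ | ⟨rfl, rfl⟩⟩) k hk hne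
    · exact hR.lt_s l i h hr k hk hne
    · exact key k hk hne
    · rw [min_comm]
      exact key k hk hne.symm

end BranchTree

/-! ### Necessity by competitors, and separation from the conditions -/

section

variable {n t : ℕ} {E : Fin n → MultSeq} {T : BranchTree n} {j : Fin t → Fin n → ℕ}

/-- Every character of `E` is needed: a position without generators can be removed. -/
theorem PChar_subset_of_isLeast (hT : T ∈ treesOf E) (hj : ∀ p, Compatible T.Glued (j p))
    (hleast : ∀ S', IsLocalArfSemigroup S' → (∀ p, vecE E (j p) ∈ S') → T.semigroup ⊆ S')
    (i : Fin n) : (E i).PChar ⊆ Set.range fun p => j p i := by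
  intro c hc
  by_contra hcr
  have hsub := hleast (indexSemigroup E T.Glued fun g => {l | g = i ∧ l = c})
    ((BranchTree.isGluing_of_mem_treesOf hT).isLocalArfSemigroup
      (by rintro g l ⟨rfl, rfl⟩; exact hc)
      ⟨c + 1, fun l hl g hg => by have := hg.2; omega⟩)
    (fun p => ⟨j p, hj p, fun g hg => hcr ⟨p, hg.1 ▸ hg.2⟩, rfl⟩)
  rw [BranchTree.semigroup_eq_indexSemigroup hT] at hsub
  -- A constant index vector is compatible with every gluing, so V_E(c, …, c) is in S(T) but not in
  -- the reduced semigroup.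
  obtain ⟨j', -, hj', e⟩ := hsub ⟨fun _ => c, fun _ _ _ => rfl, by simp, rfl⟩
  exact hj' i ⟨rfl, (congrFun (vecE_injective E e) i).symm⟩

/-- If no generator separates the branches `q` and `r` right after the last level at which they
are glued, then they can be glued further. -/
theorem exists_min_eq_of_isLeast (hT : T ∈ treesOf E) (hj : ∀ p, Compatible T.Glued (j p))
    (hleast : ∀ S', IsLocalArfSemigroup S' → (∀ p, vecE E (j p) ∈ S') → T.semigroup ⊆ S')
    {q r : Fin n} (hqr : q < r) (hlt : (T.gluingMatrix q r : ℕ∞) < kE E q r) :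
    ∃ p, j p q ≠ j p r ∧ min (j p q) (j p r) = T.gluingMatrix q r := by
  classical
  by_contra! hne
  have hR := BranchTree.isGluing_of_mem_treesOf hT
  have hsub := hleast (indexSemigroup E (T.GluedFurther q r) fun _ => ∅)
    ((BranchTree.isGluing_gluedFurther hT hqr hlt).isLocalArfSemigroup (by simp) ⟨0, by simp⟩)
    (fun p => ⟨j p, fun i h hr => ?_, by simp, rfl⟩)
  · rw [BranchTree.semigroup_eq_indexSemigroup hT] at hsub
    set P := T.gluingMatrix q r with hP
    have hqr' : ¬ T.Glued P q r := fun h => lt_irrefl _ ((hT.1.glued_iff hqr).1 h)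
    -- This vector stops at P on the branches still glued to q at level P + 1 and goes one level
    -- further on the others, r included; the extra gluing forbids it.
    have hcomp : Compatible T.Glued fun h => if T.Glued P q h then P else P + 1 := by
      intro i h hr
      have hih : T.Glued P i h := by
        dsimp only at hr
        split_ifs at hr
        · exact hr
        · exact hR.anti _ _ _ hr
      have : T.Glued P q h ↔ T.Glued P q i := by
        unfold BranchTree.Glued at hih ⊢
        rw [hih]
      simp only [this]
    obtain ⟨j', hj', -, e⟩ := hsub ⟨_, hcomp, by simp, rfl⟩
    obtain rfl := vecE_injective E e
    have hqq : T.Glued P q q := rfl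
    have := hj' q r (Or.inr ⟨if_pos hqq, Or.inl ⟨rfl, rfl⟩⟩)
    simp [hqq, hqr'] at this
  -- A generator violating the added gluing would have unequal indices at q and r with minimum
  -- exactly P, a separation excluded by `hne`.
  · rcases hr with hr | ⟨hl, ⟨rfl, rfl⟩ | ⟨rfl, rfl⟩⟩
    · exact hj p i h hr
    all_goals
      by_contra hne'
      have h2 := BranchTree.gluingMatrix_le_of_compatible hT.1 (hj p) hqr (by omega)
      refine hne p (by omega) (by omega)

theorem compatible_of_minG {T : BranchTree n} (hT : T.IsMultiplicityTree)
    (h : ∀ q r, q < r → (∀ p, j p q = j p r) ∨ minG E j q r = (T.gluingMatrix q r : ℕ∞))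
    (p : Fin t) : Compatible T.Glued (j p) := by
  have key : ∀ q r, q < r → j p q ≠ j p r → T.gluingMatrix q r ≤ min (j p q) (j p r) := by
    intro q r hqr hne
    rcases h q r hqr with h | h
    · exact absurd (h p) hne
    · exact_mod_cast h ▸ minG_le E j hne
  intro q r hr
  by_contra hne
  rcases lt_trichotomy q r with hqr | rfl | hqr
  · have h1 := key q r hqr (Ne.symm hne)
    have h2 := (hT.glued_iff hqr).1 hr
    omega
  · exact hne rfl
  · have h1 := key r q hqr hne
    have h2 := (hT.glued_iff hqr).1 hr.symm
    omega

/-- At the last level at which two branches are glued they are separated by a generator or by the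
sequences themselves. -/
theorem exists_separation (hT : T ∈ treesOf E)
    (h : ∀ q r, q < r → (T.gluingMatrix q r : ℕ∞) ≠ kE E q r →
      minG E j q r = (T.gluingMatrix q r : ℕ∞)) {l : ℕ} {i g : Fin n} (hl : T.Glued l i g)
    (hl' : ¬ T.Glued (l + 1) i g) :
    (∃ p, j p i ≠ j p g ∧ min (j p i) (j p g) = l + 1) ∨
      ∃ k, 1 ≤ k ∧ (E i).s k ≠ (E g).s k ∧ min ((E i).s k) ((E g).s k) = l + 1 := by
  have key : ∀ q r, q < r → T.Glued l q r → ¬ T.Glued (l + 1) q r →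
      (∃ p, j p q ≠ j p r ∧ min (j p q) (j p r) = l + 1) ∨
      ∃ k, 1 ≤ k ∧ (E q).s k ≠ (E r).s k ∧ min ((E q).s k) ((E r).s k) = l + 1 := by
    intro q r hqr h1 h2
    rw [hT.1.glued_iff hqr] at h1 h2
    have hP : T.gluingMatrix q r = l + 1 := by omega
    by_cases hk : (T.gluingMatrix q r : ℕ∞) = kE E q r
    · obtain ⟨k, ⟨hk1, hne⟩, hmin⟩ := exists_eq_of_biInf_eq_natCast hk.symm
      exact Or.inr ⟨k, hk1, hne, hmin.trans hP⟩
    · have hm := h q r hqr hk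
      have hinf : ⨅ p ∈ {p | j p q ≠ j p r}, ((min (j p q) (j p r) : ℕ) : ℕ∞) =
          T.gluingMatrix q r := by
        rcases min_choice (kE E q r)
          (⨅ p ∈ {p | j p q ≠ j p r}, ((min (j p q) (j p r) : ℕ) : ℕ∞)) with e | e
        · exact absurd (hm.symm.trans e) hk
        · exact e.symm.trans hm
      obtain ⟨p, hp, hmin⟩ := exists_eq_of_biInf_eq_natCast hinf
      exact Or.inl ⟨p, hp, hmin.trans hP⟩
  rcases lt_trichotomy i g with hig | rfl | hig
  · exact key i g hig hl hl'
  · exact absurd rfl hl'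
  · rcases key g i hig hl.symm fun e => hl' e.symm with ⟨p, h1, h2⟩ | ⟨k, h1, h2, h3⟩
    · exact Or.inl ⟨p, h1.symm, by rwa [min_comm]⟩
    · exact Or.inr ⟨k, h1, h2.symm, by rwa [min_comm]⟩

end

/-! ### The characterization of generating sets -/

theorem mainTheorem2 {n t : ℕ} (E : Fin n → MultSeq) (T : BranchTree n) (hT : T ∈ treesOf E)
    (Gen : Fin t → Fin n → ℕ) :
    ArfClosureEq (Set.range Gen) T.semigroup ↔
      ∃ j : Fin t → Fin n → ℕ,
        (∀ p, Gen p = vecE E (j p)) ∧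
        (∀ i, (E i).PChar ⊆ Set.range (fun p => j p i)) ∧
        (∀ q r, q < r → (T.gluingMatrix q r : ℕ∞) = kE E q r →
          (∀ p, j p q = j p r) ∨ (MinDefined j q r ∧ minG E j q r = kE E q r)) ∧
        (∀ q r, q < r → (T.gluingMatrix q r : ℕ∞) ≠ kE E q r →
          MinDefined j q r ∧ minG E j q r = (T.gluingMatrix q r : ℕ∞)) := by
  have hR := BranchTree.isGluing_of_mem_treesOf hT
  have hS := BranchTree.semigroup_eq_indexSemigroup hT
  constructor
  · rintro ⟨⟨-, hG⟩, hmin⟩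
    have hj : ∀ p, ∃ j, Compatible T.Glued j ∧ Gen p = vecE E j := fun p => by
      obtain ⟨j, hj, -, e⟩ := hS ▸ hG ⟨p, rfl⟩
      exact ⟨j, hj, e⟩
    choose j hj hGen using hj
    have hleast : ∀ S', IsLocalArfSemigroup S' → (∀ p, vecE E (j p) ∈ S') → T.semigroup ⊆ S' :=
      fun S' h h' => hmin ⟨h, Set.range_subset_iff.2 fun p => hGen p ▸ h' p⟩
    have hle : ∀ q r, q < r → (T.gluingMatrix q r : ℕ∞) ≤ minG E j q r := fun q r hqr =>
      le_min (BranchTree.gluingMatrix_le_kE hT hqr) (le_iInf₂ fun p hp => by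
        exact_mod_cast BranchTree.gluingMatrix_le_of_compatible hT.1 (hj p) hqr hp)
    refine ⟨j, hGen, PChar_subset_of_isLeast hT hj hleast, fun q r hqr he => ?_,
      fun q r hqr hne => ?_⟩
    · by_cases h : ∀ p, j p q = j p r
      · exact Or.inl h
      · push Not at h
        -- MIN is squeezed between p_{q,r} and k_E(q,r), which coincide here.
        exact Or.inr ⟨h, (min_le_left _ _).antisymm (he.symm.trans_le (hle q r hqr))⟩
    · obtain ⟨p, hp, hmin⟩ := exists_min_eq_of_isLeast hT hj hleast hqr
        (lt_of_le_of_ne (BranchTree.gluingMatrix_le_kE hT hqr) hne)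
      exact ⟨⟨p, hp⟩, (hmin ▸ minG_le E j hp).antisymm (hle q r hqr)⟩
  · rintro ⟨j, hGen, hchar, heq, hne⟩
    have hj := compatible_of_minG (E := E) (j := j) hT.1 fun q r hqr => by
      by_cases h : (T.gluingMatrix q r : ℕ∞) = kE E q r
      · exact (heq q r hqr h).imp_right fun h' => h'.2.trans h.symm
      · exact Or.inr (hne q r hqr h).2
    rw [hS]
    refine ⟨⟨hR.isLocalArfSemigroup (by simp) ⟨0, by simp⟩, Set.range_subset_iff.2 fun p =>
      ⟨j p, hj p, by simp, hGen p⟩⟩, fun S' ⟨hS', hG⟩ => ?_⟩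
    exact indexSemigroup_subset hS' hR (fun _ _ => rfl) (fun _ _ _ _ => Eq.trans) hj
      (fun p => hGen p ▸ hG ⟨p, rfl⟩) hchar
      (fun l i g => exists_separation hT fun q r hqr h => (hne q r hqr h).2) _
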